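/- **Setting.** Let $D\subseteq\mathbb R^2$ be an open set containing $(0,0)$, and let $\varphi:D\to(0,\pi)$ be a smooth solution of $\varphi_{xy}=\sin\varphi$ (the angle between the asymptotic lines of a pseudospherical surface in Chebyshev coordinates). Let $\mathcal U(x,y,\lambda)$, $(x,y)\in D$, $\lambda>0$, be the extended normalized frame with the origin as reference point, that is, $\mathcal U(\cdot,\cdot,\lambda):D\to SO(3)$ is smooth, $\mathcal U(0,0,\lambda)=I$, and $$\mathcal U^{-1}\mathcal U_x=\begin{pmatrix}0&-\varphi_x&0\\ \varphi_x&0&\lambda\\0&-\lambda&0\end{pmatrix},\qquad \mathcal U^{-1}\mathcal U_y=\frac1\lambda\begin{pmatrix}0&0&-\sin\varphi\\0&0&-\cos\varphi\\ \sin\varphi&\cos\varphi&0\end{pmatrix}.$$ Let $P=\mathrm{diag}(1,1,-1)$. A *twisted loop* is a map $g:\mathbb R_{+}\to SO(3)$ that extends analytically to $\mathbb C\setminus\{0\}$, with Laurent expansion $g(\lambda)=\sum_{k\in\mathbb Z}c_k\lambda^k$ ($c_k$ real matrices), and satisfies $Pg(\lambda)P^{-1}=g(-\lambda)$. A *Birkhoff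 splitting* of $\mathcal U(x,y,\cdot)$ is a factorization $\mathcal U=\mathcal U_+V_-$ into twisted loops with $\mathcal U_+=I+\sum_{k\ge1}\lambda^k\mathcal U_k$ and $V_-=\sum_{k\ge0}\lambda^{-k}V_{-k}$. The *normalized $x$-potential* is $\eta^x=-\lambda^{-1}\,\mathcal U_+^{-1}\,d\mathcal U_+$. Put $$\beta_0=\begin{pmatrix}0&\varphi_x(x,0)&0\\-\varphi_x(x,0)&0&0\\0&0&0\end{pmatrix}dx,\qquad \beta_1=\begin{pmatrix}0&0&0\\0&0&-1\\0&1&0\end{pmatrix}dx .$$ Let $I$ be the set of all $x$ for which the segment from $(0,0)$ to $(x,0)$ lies in $D$, and let $D_0$ be the set of all $(x,y)$ with $x\in I$ for which the segment from $(x,0)$ to $(x,y)$ lies in $D$. **Theorem ($x$-potential).** The set $D_0$ is an open neighbourhood of the origin. At each $(x,y)\in D_0$ the frame $\mathcal U(x,y,\cdot)$ has exactly one Birkhoff splitting, $\mathcal U_+(\cdot,\cdot,\lambda)$ is differentiable on $D_0$ for every $\lambda>0$, and on $D_0$ $$\eta^x=V_0(x)\,\beta_1\,V_0(x)^{-1},$$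 where $V_0:I\to GL(3,\mathbb R)$ is the unique solution of $V_0^{-1}dV_0=-\beta_0$, $V_0(0)=\mathcal U(0,0)$. Moreover $V_0(x)$ is the leading ($\lambda^0$) coefficient of $V_-(x,y,\cdot)$. Explicitly, with $a(x)=\varphi(0,0)-\varphi(x,0)$, $$V_0=\begin{pmatrix}\cos a&\sin a&0\\-\sin a&\cos a&0\\0&0&1\end{pmatrix},\qquad \eta^x=\begin{pmatrix}0&0&-\sin a\\0&0&-\cos a\\ \sin a&\cos a&0\end{pmatrix}dx .$$ In particular $\eta^x$ has values in $so(3)$ and depends neither on $y$ nor on $\lambda$. Under the Lie algebra isomorphism $so(3)\cong su(2)$ with $E_{12}\mapsto-\frac i2\sigma_3$, $E_{13}\mapsto-\frac i2\sigma_2$, $E_{23}\mapsto-\frac i2\sigma_1$ (where $E_{ij}$ has entry $1$ at $(i,j)$, $-1$ at $(j,i)$ and zeros elsewhere, and $\sigma_1,\sigma_2,\sigma_3$ are the Pauli matrices), it becomes $$\eta^x=\frac i2\begin{pmatrix}0&e^{i(\varphi(x,0)-\varphi(0,0))}\\ e^{-i(\varphi(x,0)-\varphi(0,0))}&0\end{pmatrix}dx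 .$$ -/

import Mathlib

open scoped ContDiff

/- Matrices carry the commutator bracket. -/
attribute [local instance] LieRing.ofAssociativeRing

namespace Pseudospherical

/-- Real `3 × 3` matrices. -/
abbrev M3 : Type := Matrix (Fin 3) (Fin 3) ℝ

/-- The range `ℝ₊` of the spectral parameter. -/
abbrev Rpos : Type := {r : ℝ // 0 < r}

/-- `λ`-dependent `3 × 3` matrices, with pointwise multiplication. -/
abbrev Loop : Type := Rpos → M3

/-! ### The isomorphism of `so(3)` with `su(2)` -/

/-- The Lie algebra `so(3)` of skew-symmetric real matrices. -/
abbrev so3 : LieSubalgebra ℝ M3 := LieAlgebra.Orthogonal.so (Fin 3) ℝ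

/-- The Lie algebra `su(2)` of trace-free skew-Hermitian matrices, as a real Lie algebra. -/
def su2 : LieSubalgebra ℝ (Matrix (Fin 2) (Fin 2) ℂ) where
  carrier := {X | X.conjTranspose = -X ∧ X.trace = 0}
  add_mem' := by
    rintro X Y ⟨hX, hX'⟩ ⟨hY, hY'⟩
    refine ⟨?_, by simp [Matrix.trace_add, hX', hY']⟩
    rw [Matrix.conjTranspose_add, hX, hY, neg_add]
  zero_mem' := by simp
  smul_mem' := by
    rintro r X ⟨hX, hX'⟩
    refine ⟨?_, by simp [Matrix.trace_smul, hX']⟩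
    rw [Matrix.conjTranspose_smul, hX, star_trivial, smul_neg]
  lie_mem' := by
    rintro X Y ⟨hX, _⟩ ⟨hY, _⟩
    refine ⟨?_, ?_⟩
    · rw [Ring.lie_def, Matrix.conjTranspose_sub, Matrix.conjTranspose_mul,
        Matrix.conjTranspose_mul, hX, hY]
      noncomm_ring
    · rw [Ring.lie_def, Matrix.trace_sub, Matrix.trace_mul_comm, sub_self]

/-- The first Pauli matrix. -/
def pauli1 : Matrix (Fin 2) (Fin 2) ℂ := !![0, 1; 1, 0]

/-- The second Pauli matrix. -/
def pauli2 : Matrix (Fin 2) (Fin 2) ℂ := !![0, -Complex.I; Complex.I, 0]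

/-- The third Pauli matrix. -/
def pauli3 : Matrix (Fin 2) (Fin 2) ℂ := !![1, 0; 0, -1]

/-- The linear map with `E₁₂ ↦ (-i/2) σ₃`, `E₁₃ ↦ (-i/2) σ₂`, `E₂₃ ↦ (-i/2) σ₁`, where `E_ij` has
entry `1` at `(i, j)`, entry `-1` at `(j, i)`, and zeros elsewhere. -/
noncomputable def spinMatrix (X : M3) : Matrix (Fin 2) (Fin 2) ℂ :=
  (-Complex.I / 2) •
    ((X 0 1 : ℂ) • pauli3 + (X 0 2 : ℂ) • pauli2 + (X 1 2 : ℂ) • pauli1)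

lemma spinMatrix_eq (X : M3) : spinMatrix X =
    !![⟨0, -X 0 1 / 2⟩, ⟨-X 0 2 / 2, -X 1 2 / 2⟩;
       ⟨X 0 2 / 2, -X 1 2 / 2⟩, ⟨0, X 0 1 / 2⟩] := by
  ext i j
  fin_cases i <;> fin_cases j <;> apply Complex.ext <;>
    simp [spinMatrix, pauli1, pauli2, pauli3] <;> ring

lemma spinMatrix_mem (X : M3) : spinMatrix X ∈ su2 := by
  rw [spinMatrix_eq]
  refine ⟨?_, ?_⟩
  · ext i j
    fin_cases i <;> fin_cases j <;> apply Complex.ext <;> simp <;> ring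
  · apply Complex.ext <;> simp [Matrix.trace_fin_two]; ring

lemma so3_apply (X : so3) (i j : Fin 3) : (X : M3) j i = -(X : M3) i j :=
  congrFun (congrFun ((LieAlgebra.Orthogonal.mem_so (n := Fin 3) (R := ℝ) (X : M3)).1 X.2) i) j

lemma so3_diag (X : so3) (i : Fin 3) : (X : M3) i i = 0 := by
  have := so3_apply X i i
  linarith

/-- The isomorphism of real Lie algebras `so(3) ≃ su(2)` with `E₁₂ ↦ (-i/2) σ₃`,
`E₁₃ ↦ (-i/2) σ₂`, `E₂₃ ↦ (-i/2) σ₁`. -/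
noncomputable def spin : so3 ≃ₗ⁅ℝ⁆ su2 where
  toFun X := ⟨spinMatrix X, spinMatrix_mem X⟩
  map_add' X Y := by
    apply Subtype.ext
    change spinMatrix ((X : M3) + Y) = spinMatrix X + spinMatrix Y
    simp only [spinMatrix_eq]
    ext i j
    fin_cases i <;> fin_cases j <;> apply Complex.ext <;> simp <;> ring
  map_smul' r X := by
    apply Subtype.ext
    change spinMatrix (r • (X : M3)) = r • spinMatrix X
    simp only [spinMatrix_eq]
    ext i j
    fin_cases i <;> fin_cases j <;> apply Complex.ext <;> simp <;> ring
  map_lie' {X Y} := by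
    apply Subtype.ext
    change spinMatrix ((X : M3) * Y - Y * X) =
      spinMatrix X * spinMatrix Y - spinMatrix Y * spinMatrix X
    simp only [spinMatrix_eq]
    have h1 := so3_diag X
    have h2 := so3_diag Y
    have h3 := so3_apply X
    have h4 := so3_apply Y
    ext i j
    fin_cases i <;> fin_cases j <;> apply Complex.ext <;>
      simp [Matrix.mul_apply, Fin.sum_univ_three, h1, h2, h3 0 1, h3 1 2, h4 0 1, h4 1 2] <;> ring
  invFun Z := ⟨!![0, -2 * ((Z : Matrix (Fin 2) (Fin 2) ℂ) 0 0).im,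
        2 * ((Z : Matrix (Fin 2) (Fin 2) ℂ) 1 0).re;
      2 * ((Z : Matrix (Fin 2) (Fin 2) ℂ) 0 0).im, 0, -2 * ((Z : Matrix (Fin 2) (Fin 2) ℂ) 1 0).im;
      -2 * ((Z : Matrix (Fin 2) (Fin 2) ℂ) 1 0).re, 2 * ((Z : Matrix (Fin 2) (Fin 2) ℂ) 1 0).im,
      0], by
    rw [LieAlgebra.Orthogonal.mem_so]
    ext i j
    fin_cases i <;> fin_cases j <;> simp⟩
  left_inv X := by
    apply Subtype.ext
    have h1 := so3_diag X
    have h3 := so3_apply X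
    simp only [spinMatrix_eq]
    ext i j
    fin_cases i <;> fin_cases j <;> simp [h1, h3 0 1, h3 0 2, h3 1 2] <;> ring
  right_inv Z := by
    apply Subtype.ext
    obtain ⟨Z, hZ, hZ'⟩ := Z
    have e := fun i j => congrFun (congrFun hZ i) j
    have e00 := congrArg Complex.re (e 0 0)
    have e11 := congrArg Complex.re (e 1 1)
    have r01 := congrArg Complex.re (e 0 1)
    have i01 := congrArg Complex.im (e 0 1)
    have t := congrArg Complex.im hZ'
    simp [Matrix.trace_fin_two] at e00 e11 r01 i01 t
    simp only [spinMatrix_eq]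
    ext i j
    fin_cases i <;> fin_cases j <;> apply Complex.ext <;> simp <;> linarith

end Pseudospherical

/- The norm on matrices is the maximal absolute row sum. -/
attribute [local instance] Matrix.linftyOpNormedRing
attribute [local instance] Matrix.linftyOpNormedAlgebra

namespace Pseudospherical

/-! ### Angle function and extended normalized frame -/

/-- The partial derivative `φ_x`. -/
noncomputable def partialX (φ : ℝ × ℝ → ℝ) (p : ℝ × ℝ) : ℝ :=
  deriv (fun s => φ (s, p.2)) p.1

/-- `φ` is the angle between the asymptotic lines of a (weakly regular) pseudospherical surface in
Chebyshev coordinates on `D`: a smooth solution of the sine-Gordon equation `φ_xy = sin φ` with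
values in `(0, π)`. -/
structure IsChebyshevAngle (D : Set (ℝ × ℝ)) (φ : ℝ × ℝ → ℝ) : Prop where
  smooth : ContDiffOn ℝ ∞ φ D
  pos : ∀ p ∈ D, 0 < φ p
  lt_pi : ∀ p ∈ D, φ p < Real.pi
  sineGordon : ∀ p ∈ D, deriv (fun t => partialX φ (p.1, t)) p.2 = Real.sin (φ p)

/-- The coefficient matrix `𝒜` of the Lax system. -/
noncomputable def laxA (φ : ℝ × ℝ → ℝ) (l : Rpos) (p : ℝ × ℝ) : M3 :=
  !![0, -partialX φ p, 0;
     partialX φ p, 0, (l : ℝ);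
     0, -(l : ℝ), 0]

/-- The coefficient matrix `ℬ` of the Lax system. -/
noncomputable def laxB (φ : ℝ × ℝ → ℝ) (l : Rpos) (p : ℝ × ℝ) : M3 :=
  (l : ℝ)⁻¹ • !![0, 0, -Real.sin (φ p);
                 0, 0, -Real.cos (φ p);
                 Real.sin (φ p), Real.cos (φ p), 0]

/-- `U p l` is the extended normalized frame on `D` with angle function `φ` and the origin as
reference point. -/
structure IsExtendedFrame (D : Set (ℝ × ℝ)) (φ : ℝ × ℝ → ℝ) (U : ℝ × ℝ → Loop) : Prop where
  mem_SO : ∀ p ∈ D, ∀ l, U p l ∈ Matrix.specialOrthogonalGroup (Fin 3) ℝ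
  smooth : ∀ l, ContDiffOn ℝ ∞ (fun p => U p l) D
  lax_x : ∀ p ∈ D, ∀ l, (U p l)⁻¹ * deriv (fun s => U (s, p.2) l) p.1 = laxA φ l p
  lax_y : ∀ p ∈ D, ∀ l, (U p l)⁻¹ * deriv (fun t => U (p.1, t) l) p.2 = laxB φ l p
  init : ∀ l, U (0, 0) l = 1

/-! ### Twisted loop groups and the Birkhoff splitting -/

/-- The twisting matrix `P = diag(1, 1, -1)`. -/
def twist : M3 := Matrix.diagonal ![1, 1, -1]

/-- `g : ℝ₊ → SO(3)` extends analytically to `ℂ \ {0}` with Laurent expansion `∑ c k λ ^ k`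
(real coefficients, absolutely convergent on every circle `|λ| = r`), and satisfies the twisting
condition `P g(λ) P⁻¹ = g(-λ)`, which is expressed through the coefficients. -/
structure IsTwistedLoop (g : Loop) (c : ℤ → M3) : Prop where
  mem_SO : ∀ l, g l ∈ Matrix.specialOrthogonalGroup (Fin 3) ℝ
  summable : ∀ r : ℝ, 0 < r → Summable (fun k : ℤ => ‖c k‖ * r ^ k)
  hasSum : ∀ l : Rpos, HasSum (fun k : ℤ => (l : ℝ) ^ k • c k) (g l)
  twisted : ∀ k : ℤ, twist * c k * twist⁻¹ = (-1 : ℝ) ^ k • c k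

/-- Loops of the form `I + λ c₁ + λ² c₂ + ⋯`. -/
def loopPlusStar : Set Loop :=
  {g | ∃ c, IsTwistedLoop g c ∧ (∀ k < 0, c k = 0) ∧ c 0 = 1}

/-- `g` is a loop of the form `c₀ + λ⁻¹ c₋₁ + λ⁻² c₋₂ + ⋯` with leading coefficient `c₀ = g0`. -/
def HasLeadingCoeff (g : Loop) (g0 : M3) : Prop :=
  ∃ c, IsTwistedLoop g c ∧ (∀ k > 0, c k = 0) ∧ c 0 = g0

/-- Loops of the form `c₀ + λ⁻¹ c₋₁ + λ⁻² c₋₂ + ⋯`. -/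
def loopMinus : Set Loop := {g | ∃ g0, HasLeadingCoeff g g0}

/-- `g = g₊ g₋` is the Birkhoff splitting of `g`. -/
def IsBirkhoffSplitting (g : Loop) (q : Loop × Loop) : Prop :=
  q.1 ∈ loopPlusStar ∧ q.2 ∈ loopMinus ∧ g = q.1 * q.2

open Classical in
/-- The Birkhoff factors `(g₊, g₋)` of `g`, for `g` in the big cell. -/
noncomputable def birkhoffFactors (g : Loop) : Loop × Loop :=
  if h : ∃ q, IsBirkhoffSplitting g q then h.choose else (1, 1)

/-- The factor `U₊` in `U = U₊ V₋`. -/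
noncomputable def plusFactor (U : ℝ × ℝ → Loop) (p : ℝ × ℝ) : Loop := (birkhoffFactors (U p)).1

/-- The factor `V₋` in `U = U₊ V₋`. -/
noncomputable def minusFactor (U : ℝ × ℝ → Loop) (p : ℝ × ℝ) : Loop := (birkhoffFactors (U p)).2

/-! ### The normalized `x`-potential -/

/-- The matrix valued one-form `X dx`, at a point of the plane. -/
noncomputable def formDx (X : M3) : ℝ × ℝ →L[ℝ] M3 :=
  (ContinuousLinearMap.fst ℝ ℝ ℝ).smulRight X

/-- The normalized `x`-potential `η^x = -λ⁻¹ U₊⁻¹ dU₊`. -/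
noncomputable def xPotential (U : ℝ × ℝ → Loop) (l : Rpos) (p : ℝ × ℝ) : ℝ × ℝ →L[ℝ] M3 :=
  (-(l : ℝ)⁻¹) • (ContinuousLinearMap.mul ℝ M3 (plusFactor U p l)⁻¹).comp
    (fderiv ℝ (fun q => plusFactor U q l) p)

/-- The coefficient of `dx` in `β₀`. -/
noncomputable def beta0 (φ : ℝ × ℝ → ℝ) (x : ℝ) : M3 :=
  !![0, partialX φ (x, 0), 0;
     -partialX φ (x, 0), 0, 0;
     0, 0, 0]

/-- The coefficient of `dx` in `β₁`. -/
def beta1 : M3 := !![0, 0, 0; 0, 0, -1; 0, 1, 0]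

/-- The interval of all `x` that are joined to `0` within `D` along the line `y = 0`. -/
def axisInterval (D : Set (ℝ × ℝ)) : Set ℝ := {x | ∀ s ∈ Set.uIcc 0 x, (s, (0 : ℝ)) ∈ D}

/-- The points `(x, y)` that are joined to the origin within `D` by the horizontal segment from
`(0, 0)` to `(x, 0)` followed by the vertical segment from `(x, 0)` to `(x, y)`.  This is all of
`D` if `D` is a coordinate rectangle that contains the origin. -/
def cornerRegion (D : Set (ℝ × ℝ)) : Set (ℝ × ℝ) :=
  {p | p.1 ∈ axisInterval D ∧ ∀ t ∈ Set.uIcc 0 p.2, (p.1, t) ∈ D}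

/-- `V` solves `V⁻¹ dV = -β₀`, `V(0) = V0init` on the interval `I`, with invertible values. -/
structure IsSolution (φ : ℝ × ℝ → ℝ) (I : Set ℝ) (V0init : M3) (V : ℝ → M3) : Prop where
  isUnit : ∀ x ∈ I, IsUnit (V x)
  differentiable : ∀ x ∈ I, DifferentiableAt ℝ V x
  eq : ∀ x ∈ I, (V x)⁻¹ * deriv V x = -beta0 φ x
  init : V 0 = V0init

end Pseudospherical

open Pseudospherical

/-! The splitting can be written down. With `V₀(x) = axisRot (φ(0,0) - φ(x,0))`, take `U₊ = U(x,0)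
V₀(x)⁻¹` and `V₋ = V₀(x) U(x,0)⁻¹ U(x,y)`; these are `axisPlus` and `cornerMinus`.

On the axis the Lax matrix is `-β₀ - λ β₁`, and passing from `U` to `U V₀⁻¹` removes the part free
of `λ`, leaving `U₊' = -λ U₊ (V₀ β₁ V₀⁻¹)` with `U₊ = I` at the origin (`hasDerivAt_axisPlus`).
Vertically the Lax matrix is a pure multiple of `λ⁻¹`, so `U(x,0)⁻¹ U(x,y)` solves a linear equation
with parameter `1/λ`, again starting at `I`. Picard iteration (`hasSum_picardCoeff`) makes solutions
of such equations everywhere convergent power series in the parameter with constant term `I`. Both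
coefficient matrices are of the form `conjBeta`, whose sign is reversed by conjugation with `P`, and
this gives the twisting (`exists_twisted_series`).

The splitting is unique by Liouville's theorem (`IsBirkhoffSplitting.unique`), so the chosen factors
are these explicit ones. Since `U₊` depends on `x` alone, its differential equation is the formula
for `η^x`. -/

namespace Pseudospherical

open Set

/-! ### Picard iteration for linear equations -/

section Picard

variable {A : Type*} [NormedRing A] [NormedAlgebra ℝ A]

/-- The coefficient of `μ ^ k` in the solution of `X' = μ X C`, `X 0 = 1`. -/
noncomputable def picardCoeff (C : ℝ → A) : ℕ → ℝ → A
  | 0, _ => 1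
  | k + 1, s => ∫ u in (0 : ℝ)..s, picardCoeff C k u * C u

lemma hasDerivAt_picardCoeff_succ_of_continuous [CompleteSpace A] {C : ℝ → A} (hC : Continuous C)
    {k : ℕ} (h : Continuous (picardCoeff C k)) (s : ℝ) :
    HasDerivAt (picardCoeff C (k + 1)) (picardCoeff C k s * C s) s :=
  (h.mul hC).integral_hasStrictDerivAt 0 s |>.hasDerivAt

lemma continuous_picardCoeff [CompleteSpace A] {C : ℝ → A} (hC : Continuous C) (k : ℕ) :
    Continuous (picardCoeff C k) := by
  induction k with
  | zero => exact continuous_const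
  | succ k ih =>
    exact continuous_iff_continuousAt.2 fun s =>
      (hasDerivAt_picardCoeff_succ_of_continuous hC ih s).continuousAt

lemma hasDerivAt_picardCoeff_succ [CompleteSpace A] {C : ℝ → A} (hC : Continuous C) (k : ℕ)
    (s : ℝ) : HasDerivAt (picardCoeff C (k + 1)) (picardCoeff C k s * C s) s :=
  hasDerivAt_picardCoeff_succ_of_continuous hC (continuous_picardCoeff hC k) s

lemma picardCoeff_succ_zero (C : ℝ → A) (k : ℕ) : picardCoeff C (k + 1) 0 = 0 := by
  simp [picardCoeff]

/-- A bounded algebra endomorphism that changes the sign of `C` multiplies the `k`-th coefficient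
by `(-1) ^ k`. -/
lemma map_picardCoeff [CompleteSpace A] {C : ℝ → A} (hC : Continuous C) (T : A →L[ℝ] A)
    (hT1 : T 1 = 1) (hTmul : ∀ a b, T (a * b) = T a * T b) (hTC : ∀ s, T (C s) = -C s)
    (k : ℕ) (s : ℝ) : T (picardCoeff C k s) = (-1 : ℝ) ^ k • picardCoeff C k s := by
  induction k generalizing s with
  | zero => simp [picardCoeff, hT1]
  | succ k ih =>
    have hint : IntervalIntegrable (fun u => picardCoeff C k u * C u) MeasureTheory.volume 0 s :=
      ((continuous_picardCoeff hC k).mul hC).intervalIntegrable 0 s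
    simp only [picardCoeff]
    rw [← T.intervalIntegral_comp_comm hint, ← intervalIntegral.integral_smul]
    congr 1
    ext u
    rw [hTmul, ih, hTC, pow_succ]
    simp

/-- Iterated integration on `[0, 1]` gains a factor `1 / k!`. -/
lemma norm_le_of_hasDerivAt_mul {f : ℕ → ℝ → A} {c : ℝ → A} {K M : ℝ}
    (hf0 : ∀ s ∈ Icc (0 : ℝ) 1, ‖f 0 s‖ ≤ K) (hc : ∀ s ∈ Icc (0 : ℝ) 1, ‖c s‖ ≤ M)
    (hinit : ∀ k, f (k + 1) 0 = 0)
    (hderiv : ∀ k, ∀ s ∈ Icc (0 : ℝ) 1, HasDerivAt (f (k + 1)) (f k s * c s) s)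
    (k : ℕ) : ∀ s ∈ Icc (0 : ℝ) 1, ‖f k s‖ ≤ K * ((M * s) ^ k / k.factorial) := by
  have hK : 0 ≤ K := (norm_nonneg _).trans (hf0 0 (by simp))
  have hM : 0 ≤ M := (norm_nonneg _).trans (hc 0 (by simp))
  induction k with
  | zero => simpa using hf0
  | succ k ih =>
    refine image_norm_le_of_norm_deriv_right_le_deriv_boundary
      (f' := fun s => f k s * c s) (B' := fun s => K * ((M * s) ^ k / k.factorial) * M)
      (fun s hs => (hderiv k s hs).continuousAt.continuousWithinAt)
      (fun s hs => (hderiv k s (Ico_subset_Icc_self hs)).hasDerivWithinAt)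
      (by simp [hinit]) (fun s => ?_) (fun s hs => ?_)
    -- The majorant for index `k + 1` has as its derivative exactly the bound for index `k` times
    -- `M`.
    · have h := ((((hasDerivAt_id s).const_mul M).pow (k + 1)).div_const
        ((k + 1).factorial : ℝ)).const_mul K
      refine h.congr_deriv ?_
      have h1 : ((k + 1).factorial : ℝ) = (k + 1) * k.factorial := by
        rw [Nat.factorial_succ]; push_cast; ring
      have h2 : (k.factorial : ℝ) ≠ 0 := by positivity
      have h3 : (k : ℝ) + 1 ≠ 0 := by positivity
      rw [h1]
      simp
      field_simp
    · have hs' := Ico_subset_Icc_self hs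
      have := hs'.1
      exact (norm_mul_le _ _).trans
        (mul_le_mul (ih s hs') (hc s hs') (norm_nonneg _) (by positivity))

lemma norm_picardCoeff_one_le [CompleteSpace A] {C : ℝ → A} (hC : Continuous C) {M : ℝ}
    (hM : ∀ s ∈ Icc (0 : ℝ) 1, ‖C s‖ ≤ M) (k : ℕ) :
    ‖picardCoeff C k 1‖ ≤ ‖(1 : A)‖ * (M ^ k / k.factorial) := by
  simpa using norm_le_of_hasDerivAt_mul (f := picardCoeff C) (K := ‖(1 : A)‖)
    (fun s _ => by simp [picardCoeff]) hM (picardCoeff_succ_zero C)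
    (fun k s _ => hasDerivAt_picardCoeff_succ hC k s) k 1 (by simp)

lemma summable_norm_picardCoeff [CompleteSpace A] {C : ℝ → A} (hC : Continuous C) {r : ℝ}
    (hr : 0 ≤ r) : Summable fun k => ‖picardCoeff C k 1‖ * r ^ k := by
  obtain ⟨M, hM⟩ := isCompact_Icc.exists_bound_of_continuousOn (hC.continuousOn (s := Icc 0 1))
  refine Summable.of_nonneg_of_le (fun k => by positivity) (fun k => ?_)
    ((Real.summable_pow_div_factorial (M * r)).mul_left ‖(1 : A)‖)
  refine (mul_le_mul_of_nonneg_right (norm_picardCoeff_one_le hC hM k) (by positivity)).trans ?_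
  rw [mul_pow]
  exact le_of_eq (by ring)

/-- The value at `1` of the solution of `X' = μ X C`, `X 0 = 1` is a power series in `μ`. -/
lemma hasSum_picardCoeff [CompleteSpace A] {C : ℝ → A} (hC : Continuous C) {μ : ℝ} (hμ : 0 ≤ μ)
    {X : ℝ → A} (hX0 : X 0 = 1)
    (hX : ∀ s ∈ Icc (0 : ℝ) 1, HasDerivAt X (μ • (X s * C s)) s) :
    HasSum (fun k => μ ^ k • picardCoeff C k 1) (X 1) := by
  obtain ⟨M, hM⟩ := isCompact_Icc.exists_bound_of_continuousOn (hC.continuousOn (s := Icc 0 1))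
  obtain ⟨K, hK⟩ := isCompact_Icc.exists_bound_of_continuousOn
    (fun s hs => (hX s hs).continuousAt.continuousWithinAt : ContinuousOn X (Icc 0 1))
  have hsum : Summable fun k => μ ^ k • picardCoeff C k 1 := by
    refine Summable.of_norm ((summable_norm_picardCoeff hC hμ).congr fun k => ?_)
    rw [norm_smul, norm_pow, Real.norm_of_nonneg hμ, mul_comm]
  rw [hsum.hasSum_iff_tendsto_nat]
  -- The remainders obey the same recursion as the coefficients, with `C` replaced by `μ C`. Only
  -- the starting function `R 0 = X` differs, and it is bounded on `[0, 1]`, so the factorial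
  -- estimate applies to them too.
  set R : ℕ → ℝ → A := fun n s => X s - ∑ k ∈ Finset.range n, μ ^ k • picardCoeff C k s with hR
  have hbound := norm_le_of_hasDerivAt_mul (f := R) (c := fun s => μ • C s) (K := K) (M := μ * M)
    (fun s hs => by simpa [hR] using hK s hs)
    (fun s hs => by
      rw [norm_smul, Real.norm_of_nonneg hμ]
      exact mul_le_mul_of_nonneg_left (hM s hs) hμ)
    (fun k => by simp [hR, Finset.sum_range_succ', hX0, picardCoeff])
    (fun k s hs => by
      have h1 : HasDerivAt
          (fun s => ∑ j ∈ Finset.range k, μ ^ (j + 1) • picardCoeff C (j + 1) s)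
          (∑ j ∈ Finset.range k, μ ^ (j + 1) • (picardCoeff C j s * C s)) s :=
        HasDerivAt.fun_sum fun j _ => (hasDerivAt_picardCoeff_succ hC j s).fun_const_smul _
      have h2 := (hX s hs).sub (h1.add_const (1 : A))
      -- The term of index zero is the constant `1`; splitting it off shifts the index in the
      -- derivative.
      have h3 : R (k + 1) =
          X - fun s => ∑ j ∈ Finset.range k, μ ^ (j + 1) • picardCoeff C (j + 1) s + 1 := by
        ext s
        simp [hR, Finset.sum_range_succ', picardCoeff]
      rw [h3]
      refine h2.congr_deriv ?_
      simp only [hR, sub_mul, Finset.sum_mul, mul_smul_comm, smul_mul_assoc, smul_sub,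
        Finset.smul_sum, smul_smul, pow_succ'])
  have hlim : Filter.Tendsto (fun n => R n 1) Filter.atTop (nhds 0) := by
    refine squeeze_zero_norm (fun n => hbound n 1 (by simp)) ?_
    have := (FloorSemiring.tendsto_pow_div_factorial_atTop (μ * M * 1)).const_mul K
    simpa using this
  have := (tendsto_const_nhds (x := X 1)).sub hlim
  simpa [hR] using this

end Picard

/-! ### Entire functions -/

lemma differentiable_tsum_pow {a : ℕ → ℝ} (ha : ∀ r : ℝ, 0 < r → Summable fun k => |a k| * r ^ k) :
    Differentiable ℂ fun z : ℂ => ∑' k, (a k : ℂ) * z ^ k := by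
  intro z
  have h : DifferentiableOn ℂ (fun z : ℂ => ∑' k, (a k : ℂ) * z ^ k)
      (Metric.ball 0 (‖z‖ + 1)) := by
    refine Complex.differentiableOn_tsum_of_summable_norm (ha (‖z‖ + 1) (by positivity))
      (fun k => by fun_prop) Metric.isOpen_ball (fun k w hw => ?_)
    rw [norm_mul, norm_pow, Complex.norm_real, Real.norm_eq_abs]
    have : ‖w‖ ≤ ‖z‖ + 1 := (mem_ball_zero_iff.1 hw).le
    gcongr
  exact h.differentiableAt (Metric.isOpen_ball.mem_nhds (by simp))

/-- An entire function that agrees on the positive half-line with an entire function of `1 / z` is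
constant. -/
lemma eq_const_of_eq_inv {F E : ℂ → ℂ} (hF : Differentiable ℂ F) (hE : Differentiable ℂ E)
    (h : ∀ r : ℝ, 0 < r → F r = E (r : ℂ)⁻¹) (z : ℂ) : F z = F 0 := by
  have hopen : IsOpen ({0}ᶜ : Set ℂ) := isOpen_compl_singleton
  have hEinv : DifferentiableOn ℂ (fun z => E z⁻¹) {0}ᶜ :=
    hE.comp_differentiableOn (differentiableOn_id.inv fun z hz => hz)
  have hconn : IsPreconnected ({0}ᶜ : Set ℂ) :=
    (isConnected_compl_singleton_of_one_lt_rank (by simp) 0).isPreconnected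
  -- The points `1 + 1 / (n + 1)` of the half-line accumulate at `1`, which is all that the identity
  -- theorem on the connected set `ℂ \ {0}` needs.
  have hfreq : ∃ᶠ w in nhdsWithin (1 : ℂ) {1}ᶜ, F w = E w⁻¹ := by
    have ht : Filter.Tendsto (fun n : ℕ => ((1 + 1 / ((n : ℝ) + 1) : ℝ) : ℂ)) Filter.atTop
        (nhdsWithin (1 : ℂ) {1}ᶜ) := by
      refine tendsto_nhdsWithin_iff.2 ⟨?_, Filter.Eventually.of_forall fun n hn => ?_⟩
      · have := (tendsto_one_div_add_atTop_nhds_zero_nat (𝕜 := ℝ)).const_add 1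
        rw [add_zero] at this
        exact (Complex.continuous_ofReal.tendsto 1).comp this
      · have h1 : (1 + 1 / ((n : ℝ) + 1) : ℝ) = 1 := Complex.ofReal_eq_one.1 hn
        have : 0 < 1 / ((n : ℝ) + 1) := by positivity
        linarith
    exact ht.frequently (Filter.Frequently.of_forall fun n => h _ (by positivity))
  have heq : EqOn F (fun z => E z⁻¹) {0}ᶜ :=
    (hF.differentiableOn.analyticOnNhd hopen).eqOn_of_preconnected_of_frequently_eq
      (hEinv.analyticOnNhd hopen) hconn (z₀ := 1) (by simp) hfreq
  -- Liouville: `F` is bounded on the closed unit disc by compactness, and outside it by the values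
  -- of `E` on that disc.
  refine hF.apply_eq_apply_of_bounded ?_ z 0
  obtain ⟨K₁, hK₁⟩ := (isCompact_closedBall (0 : ℂ) 1).exists_bound_of_continuousOn
    hF.continuous.continuousOn
  obtain ⟨K₂, hK₂⟩ := (isCompact_closedBall (0 : ℂ) 1).exists_bound_of_continuousOn
    hE.continuous.continuousOn
  refine (Metric.isBounded_closedBall (x := (0 : ℂ)) (r := max K₁ K₂)).subset ?_
  rintro _ ⟨w, rfl⟩
  rw [mem_closedBall_zero_iff]
  rcases le_total ‖w‖ 1 with hw | hw
  · exact (hK₁ w (by simpa using hw)).trans (le_max_left _ _)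
  · have hw0 : w ≠ 0 := by rintro rfl; norm_num at hw
    rw [heq hw0]
    refine (hK₂ _ ?_).trans (le_max_right _ _)
    rw [mem_closedBall_zero_iff, norm_inv]
    exact inv_le_one_of_one_le₀ hw

/-! ### Uniqueness of the Birkhoff splitting -/

lemma SO_mul_transpose {g : M3} (hg : g ∈ Matrix.specialOrthogonalGroup (Fin 3) ℝ) :
    g * g.transpose = 1 :=
  (Matrix.mem_orthogonalGroup_iff (Fin 3) ℝ).1 (Matrix.mem_specialOrthogonalGroup_iff.1 hg).1

lemma SO_transpose_mul {g : M3} (hg : g ∈ Matrix.specialOrthogonalGroup (Fin 3) ℝ) :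
    g.transpose * g = 1 :=
  (Matrix.mem_orthogonalGroup_iff' (Fin 3) ℝ).1 (Matrix.mem_specialOrthogonalGroup_iff.1 hg).1

lemma SO_inv {g : M3} (hg : g ∈ Matrix.specialOrthogonalGroup (Fin 3) ℝ) :
    g⁻¹ = g.transpose :=
  Matrix.inv_eq_left_inv (SO_transpose_mul hg)

lemma SO_transpose_mem {g : M3} (hg : g ∈ Matrix.specialOrthogonalGroup (Fin 3) ℝ) :
    g.transpose ∈ Matrix.specialOrthogonalGroup (Fin 3) ℝ := by
  rw [Matrix.mem_specialOrthogonalGroup_iff, Matrix.mem_orthogonalGroup_iff]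
  refine ⟨?_, ?_⟩
  · simpa [Matrix.star_eq_conjTranspose] using SO_transpose_mul hg
  · rw [Matrix.det_transpose]
    exact (Matrix.mem_specialOrthogonalGroup_iff.1 hg).2

lemma abs_entry_le_norm (X : M3) (i j : Fin 3) : |X i j| ≤ ‖X‖ := by
  rw [Matrix.linfty_opNorm_def, ← Real.norm_eq_abs, ← coe_nnnorm, NNReal.coe_le_coe]
  exact (Finset.single_le_sum (f := fun j => ‖X i j‖₊) (fun _ _ => zero_le)
    (Finset.mem_univ j)).trans (Finset.le_sup (f := fun i => ∑ j, ‖X i j‖₊) (Finset.mem_univ i))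

lemma hasSum_entry {ι : Type*} {f : ι → M3} {X : M3} (h : HasSum f X) (i j : Fin 3) :
    HasSum (fun k => f k i j) (X i j) :=
  h.map (Matrix.entryLinearMap ℝ ℝ i j) (continuous_id.matrix_elem i j)

/-- The entries of a matrix power series with infinite radius of convergence are entire. -/
lemma exists_entire_entry {w : ℕ → M3} (hw : ∀ r : ℝ, 0 < r → Summable fun k => ‖w k‖ * r ^ k)
    (i j : Fin 3) : ∃ F : ℂ → ℂ, Differentiable ℂ F ∧ F 0 = (w 0 i j : ℂ) ∧
      ∀ (r : ℝ) (X : M3), HasSum (fun k => r ^ k • w k) X → F r = (X i j : ℂ) := by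
  refine ⟨fun z => ∑' k, ((w k i j : ℝ) : ℂ) * z ^ k,
    differentiable_tsum_pow fun r hr => ?_, ?_, fun r X hX => ?_⟩
  · refine Summable.of_nonneg_of_le (fun k => by positivity) (fun k => ?_)
      (hw r hr)
    exact mul_le_mul_of_nonneg_right (abs_entry_le_norm (w k) i j) (by positivity)
  · dsimp only
    rw [tsum_eq_single 0 (fun k hk => by simp [hk])]
    simp
  · have h := Complex.hasSum_ofReal.2 (hasSum_entry hX i j)
    rw [← h.tsum_eq]
    refine tsum_congr fun k => ?_
    rw [Matrix.smul_apply, smul_eq_mul]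
    push_cast
    ring

lemma injective_neg_natCast : Function.Injective fun k : ℕ => -(k : ℤ) := by
  intro a b h
  simpa using h

/-- With no negative powers the Laurent series is a power series. The value at `0` later identifies
the constant in Liouville's theorem. -/
lemma exists_entire_of_mem_loopPlusStar {g : Loop} (hg : g ∈ loopPlusStar) (i j : Fin 3) :
    ∃ F : ℂ → ℂ, Differentiable ℂ F ∧ F 0 = ((1 : M3) i j : ℂ) ∧
      ∀ l : Rpos, F (l : ℝ) = (g l i j : ℂ) := by
  obtain ⟨c, hc, hneg, hc0⟩ := hg
  obtain ⟨F, hF, hF0, hFs⟩ := exists_entire_entry (w := fun k : ℕ => c k) (fun r hr => by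
    simpa [Function.comp_def] using
      (hc.summable r hr).comp_injective (Nat.cast_injective (R := ℤ))) i j
  refine ⟨F, hF, by simpa [hc0] using hF0, fun l => hFs l _ ?_⟩
  have := (Nat.cast_injective (R := ℤ)).hasSum_iff (f := fun k : ℤ => (l : ℝ) ^ k • c k)
    (a := g l) fun k hk => by
      rw [hneg k (by by_contra! h; exact hk ⟨k.toNat, Int.toNat_of_nonneg h⟩), smul_zero]
  simpa [Function.comp_def] using this.2 (hc.hasSum l)

/-- This is the same argument in the variable `1/λ`. No value at `0` is recorded: the normalization
of the plus factors alone fixes the constant. -/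
lemma exists_entire_of_mem_loopMinus {g : Loop} (hg : g ∈ loopMinus) (i j : Fin 3) :
    ∃ E : ℂ → ℂ, Differentiable ℂ E ∧ ∀ l : Rpos, E ((l : ℝ) : ℂ)⁻¹ = (g l i j : ℂ) := by
  obtain ⟨g0, c, hc, hpos, -⟩ := hg
  obtain ⟨F, hF, -, hFs⟩ := exists_entire_entry (w := fun k : ℕ => c (-k)) (fun r hr => by
    simpa [Function.comp_def] using
      (hc.summable r⁻¹ (inv_pos.2 hr)).comp_injective injective_neg_natCast) i j
  refine ⟨F, hF, fun l => ?_⟩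
  rw [← Complex.ofReal_inv]
  refine hFs _ _ ?_
  have := injective_neg_natCast.hasSum_iff (f := fun k : ℤ => (l : ℝ) ^ k • c k)
    (a := g l) fun k hk => by
      rw [hpos k (by by_contra! h; exact hk ⟨(-k).toNat, by simp; omega⟩), smul_zero]
  simpa [Function.comp_def] using this.2 (hc.hasSum l)

lemma mem_SO_of_mem_loopPlusStar {g : Loop} (hg : g ∈ loopPlusStar) (l : Rpos) :
    g l ∈ Matrix.specialOrthogonalGroup (Fin 3) ℝ := by
  obtain ⟨c, hc, -⟩ := hg
  exact hc.mem_SO l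

lemma mem_SO_of_mem_loopMinus {g : Loop} (hg : g ∈ loopMinus) (l : Rpos) :
    g l ∈ Matrix.specialOrthogonalGroup (Fin 3) ℝ := by
  obtain ⟨g0, c, hc, -⟩ := hg
  exact hc.mem_SO l

/-- From `g₊ g₋ = g₊' g₋'` follows `g₊'⁻¹ g₊ = g₋' g₋⁻¹`, with the left side entire in `λ` and the
right side entire in `1/λ`; hence both are constant. Inverses in `SO(3)` are transposes, so the
entries of both sides are sums of products of entire functions, and no power series has to be
inverted. -/
lemma IsBirkhoffSplitting.unique {g : Loop} {q q' : Loop × Loop} (hq : IsBirkhoffSplitting g q)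
    (hq' : IsBirkhoffSplitting g q') : q = q' := by
  obtain ⟨hp, hm, he⟩ := hq
  obtain ⟨hp', hm', he'⟩ := hq'
  have hso := mem_SO_of_mem_loopPlusStar hp'
  have hprod : ∀ l, q.1 l * q.2 l = q'.1 l * q'.2 l := fun l => congrFun (he.symm.trans he') l
  have hmix : ∀ l, (q'.1 l).transpose * q.1 l = q'.2 l * (q.2 l).transpose := fun l => by
    calc (q'.1 l).transpose * q.1 l
        = (q'.1 l).transpose * (q.1 l * q.2 l) * (q.2 l).transpose := by
          rw [mul_assoc, mul_assoc, SO_mul_transpose (mem_SO_of_mem_loopMinus hm l), mul_one]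
      _ = (q'.1 l).transpose * q'.1 l * q'.2 l * (q.2 l).transpose := by
          rw [hprod]; simp only [mul_assoc]
      _ = q'.2 l * (q.2 l).transpose := by rw [SO_transpose_mul (hso l), one_mul]
  have hone : ∀ l, (q'.1 l).transpose * q.1 l = 1 := by
    intro l
    ext i j
    choose F hF hF0 hFl using exists_entire_of_mem_loopPlusStar hp
    choose F' hF' hF0' hFl' using exists_entire_of_mem_loopPlusStar hp'
    choose E hE hEl using exists_entire_of_mem_loopMinus hm
    choose E' hE' hEl' using exists_entire_of_mem_loopMinus hm'
    have key := eq_const_of_eq_inv (F := fun z => ∑ k, F' k i z * F k j z)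
      (E := fun z => ∑ k, E' i k z * E j k z)
      (Differentiable.fun_sum fun k _ => (hF' k i).mul (hF k j))
      (Differentiable.fun_sum fun k _ => (hE' i k).mul (hE j k))
      (fun r hr => by
        have h := congrArg (fun x : ℝ => (x : ℂ)) (congrFun (congrFun (hmix ⟨r, hr⟩) i) j)
        simp only [Matrix.mul_apply, Matrix.transpose_apply, Complex.ofReal_sum,
          Complex.ofReal_mul, ← hFl, ← hFl', ← hEl, ← hEl'] at h
        exact h) ((l : ℝ) : ℂ)
    -- At `λ = 0` both plus factors are the identity, so the constant is the identity.
    simp only [hFl, hFl', hF0, hF0'] at key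
    have key' : ((q'.1 l).transpose * q.1 l) i j = ((1 : M3).transpose * (1 : M3)) i j := by
      simp only [Matrix.mul_apply, Matrix.transpose_apply]
      exact_mod_cast key
    simpa using key'
  have h1 : q.1 = q'.1 := by
    funext l
    calc q.1 l = q'.1 l * (q'.1 l).transpose * q.1 l := by
          rw [SO_mul_transpose (hso l), one_mul]
      _ = q'.1 l := by rw [mul_assoc, hone, mul_one]
  refine Prod.ext h1 (funext fun l => ?_)
  calc q.2 l = (q'.1 l).transpose * (q.1 l * q.2 l) := by
        rw [← mul_assoc, h1, SO_transpose_mul (hso l), one_mul]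
    _ = q'.2 l := by rw [hprod, ← mul_assoc, SO_transpose_mul (hso l), one_mul]

lemma IsBirkhoffSplitting.birkhoffFactors_eq {g : Loop} {q : Loop × Loop}
    (hq : IsBirkhoffSplitting g q) : birkhoffFactors g = q := by
  have h : ∃ q, IsBirkhoffSplitting g q := ⟨q, hq⟩
  rw [birkhoffFactors, dif_pos h]
  exact h.choose_spec.unique hq

/-! ### Loops from power series -/

lemma mem_loopPlusStar_of_hasSum {g : Loop} {w : ℕ → M3}
    (hg : ∀ l, g l ∈ Matrix.specialOrthogonalGroup (Fin 3) ℝ) (hw0 : w 0 = 1)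
    (hw : ∀ r : ℝ, 0 < r → Summable fun k => ‖w k‖ * r ^ k)
    (htw : ∀ k, twist * w k * twist⁻¹ = (-1 : ℝ) ^ k • w k)
    (hsum : ∀ l : Rpos, HasSum (fun k => (l : ℝ) ^ k • w k) (g l)) : g ∈ loopPlusStar := by
  have hneg : ∀ k : ℤ, k ∉ range (Nat.cast : ℕ → ℤ) → ¬ 0 ≤ k := fun k hk h =>
    hk ⟨k.toNat, Int.toNat_of_nonneg h⟩
  refine ⟨fun k => if 0 ≤ k then w k.toNat else 0, ⟨hg, fun r hr => ?_, fun l => ?_, fun k => ?_⟩,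
    fun k hk => if_neg (not_le.2 hk), by simpa using hw0⟩
  · refine ((Nat.cast_injective (R := ℤ)).summable_iff fun k hk => ?_).1 ?_
    · simp [hneg k hk]
    · simpa [Function.comp_def] using hw r hr
  · refine ((Nat.cast_injective (R := ℤ)).hasSum_iff fun k hk => ?_).1 ?_
    · simp [hneg k hk]
    · simpa [Function.comp_def] using hsum l
  · by_cases hk : 0 ≤ k
    · lift k to ℕ using hk
      simpa using htw k
    · simp [hk]

lemma hasLeadingCoeff_of_hasSum {g : Loop} {w : ℕ → M3}
    (hg : ∀ l, g l ∈ Matrix.specialOrthogonalGroup (Fin 3) ℝ)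
    (hw : ∀ r : ℝ, 0 < r → Summable fun k => ‖w k‖ * r ^ k)
    (htw : ∀ k, twist * w k * twist⁻¹ = (-1 : ℝ) ^ k • w k)
    (hsum : ∀ l : Rpos, HasSum (fun k => (l : ℝ)⁻¹ ^ k • w k) (g l)) :
    HasLeadingCoeff g (w 0) := by
  have hpos : ∀ k : ℤ, k ∉ range (fun k : ℕ => -(k : ℤ)) → ¬ k ≤ 0 := fun k hk h =>
    hk ⟨(-k).toNat, by simp; omega⟩
  refine ⟨fun k => if k ≤ 0 then w (-k).toNat else 0,
    ⟨hg, fun r hr => ?_, fun l => ?_, fun k => ?_⟩,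
    fun k hk => if_neg (not_le.2 hk), by simp⟩
  · refine (injective_neg_natCast.summable_iff fun k hk => ?_).1 ?_
    · simp [hpos k hk]
    · simpa [Function.comp_def] using hw r⁻¹ (inv_pos.2 hr)
  · refine (injective_neg_natCast.hasSum_iff fun k hk => ?_).1 ?_
    · simp [hpos k hk]
    · simpa [Function.comp_def] using hsum l
  · by_cases hk : k ≤ 0
    · obtain ⟨n, rfl⟩ : ∃ n : ℕ, k = -n := ⟨(-k).toNat, by omega⟩
      -- The twisting sign depends only on parity, so it survives the reindexing `k ↦ -k`.
      have h1 : ((-1 : ℝ) ^ n)⁻¹ = (-1) ^ n := by rw [← inv_pow]; norm_num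
      simpa [h1] using htw n
    · simp [hk]

/-! ### Rotations about the third axis -/

/-- The infinitesimal generator of `axisRot`. -/
def axisGen : M3 := !![0, 1, 0; -1, 0, 0; 0, 0, 0]

/-- The rotation by the angle `a` about the third axis. -/
noncomputable def axisRot (a : ℝ) : M3 :=
  !![Real.cos a, Real.sin a, 0; -Real.sin a, Real.cos a, 0; 0, 0, 1]

/-- The matrix `V₀ β₁ V₀⁻¹` for `V₀ = axisRot a`. -/
noncomputable def conjBeta (a : ℝ) : M3 :=
  !![0, 0, -Real.sin a; 0, 0, -Real.cos a; Real.sin a, Real.cos a, 0]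

lemma axisRot_eq (a : ℝ) : axisRot a =
    Real.cos a • !![1, 0, 0; 0, 1, 0; 0, 0, 0] + Real.sin a • axisGen
      + !![0, 0, 0; 0, 0, 0; 0, 0, 1] := by
  ext i j
  fin_cases i <;> fin_cases j <;> simp [axisRot, axisGen]

lemma conjBeta_eq (a : ℝ) : conjBeta a =
    Real.sin a • !![0, 0, -1; 0, 0, 0; 1, 0, 0] + Real.cos a • beta1 := by
  ext i j
  fin_cases i <;> fin_cases j <;> simp [conjBeta, beta1]

lemma axisRot_zero : axisRot 0 = 1 := by
  ext i j
  fin_cases i <;> fin_cases j <;> simp [axisRot]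

lemma axisRot_mul_neg (a : ℝ) : axisRot a * axisRot (-a) = 1 := by
  have := Real.sin_sq_add_cos_sq a
  ext i j
  fin_cases i <;> fin_cases j <;> simp [axisRot, Matrix.mul_apply, Fin.sum_univ_three] <;>
    linarith

lemma axisRot_neg_mul (a : ℝ) : axisRot (-a) * axisRot a = 1 := by
  simpa using axisRot_mul_neg (-a)

lemma axisRot_mul_conj (a : ℝ) : axisRot a * beta1 * axisRot (-a) = conjBeta a := by
  ext i j
  fin_cases i <;> fin_cases j <;>
    simp [axisRot, conjBeta, beta1, Matrix.mul_apply, Fin.sum_univ_three]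

lemma axisRot_mem_SO (a : ℝ) : axisRot a ∈ Matrix.specialOrthogonalGroup (Fin 3) ℝ := by
  have h : (axisRot a).transpose = axisRot (-a) := by
    ext i j
    fin_cases i <;> fin_cases j <;> simp [axisRot]
  rw [Matrix.mem_specialOrthogonalGroup_iff, Matrix.mem_orthogonalGroup_iff]
  refine ⟨?_, ?_⟩
  · simpa [Matrix.star_eq_conjTranspose, h] using axisRot_mul_neg a
  · have := Real.sin_sq_add_cos_sq a
    simp [axisRot, Matrix.det_fin_three]
    linarith

lemma axisRot_inv (a : ℝ) : (axisRot a)⁻¹ = axisRot (-a) :=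
  Matrix.inv_eq_left_inv (axisRot_neg_mul a)

lemma isUnit_axisRot (a : ℝ) : IsUnit (axisRot a) :=
  ⟨⟨axisRot a, axisRot (-a), axisRot_mul_neg a, axisRot_neg_mul a⟩, rfl⟩

lemma axisRot_mul_axisGen (a : ℝ) : axisRot a * axisGen =
    -Real.sin a • !![1, 0, 0; 0, 1, 0; 0, 0, 0] + Real.cos a • axisGen := by
  ext i j
  fin_cases i <;> fin_cases j <;>
    simp [axisRot, axisGen, Matrix.mul_apply, Fin.sum_univ_three]

lemma axisRot_axisGen_comm (a : ℝ) : axisRot a * axisGen = axisGen * axisRot a := by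
  ext i j
  fin_cases i <;> fin_cases j <;>
    simp [axisRot, axisGen, Matrix.mul_apply, Fin.sum_univ_three]

lemma hasDerivAt_axisRot (a : ℝ) : HasDerivAt axisRot (axisRot a * axisGen) a := by
  rw [axisRot_mul_axisGen, funext axisRot_eq]
  exact (((Real.hasDerivAt_cos a).smul_const _).add
    ((Real.hasDerivAt_sin a).smul_const _)).add_const _

lemma continuous_conjBeta : Continuous conjBeta := by
  rw [funext conjBeta_eq]
  fun_prop

lemma twist_mul_twist : twist * twist = 1 := by
  ext i j
  fin_cases i <;> fin_cases j <;> simp [twist, Matrix.mul_apply, Fin.sum_univ_three]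

lemma twist_inv : twist⁻¹ = twist := Matrix.inv_eq_left_inv twist_mul_twist

/-- The nonzero entries lie in the third row and column, off the diagonal, where conjugation by `P`
changes the sign. Each Picard step therefore contributes a factor `-1`. -/
lemma twist_conjBeta (a : ℝ) : twist * conjBeta a * twist = -conjBeta a := by
  ext i j
  fin_cases i <;> fin_cases j <;>
    simp [twist, conjBeta, Matrix.mul_apply, Matrix.diagonal_apply]

/-- Rotations about the third axis have even parity, so multiplying a twisted series by one keeps it
twisted. -/
lemma twist_axisRot_comm (a : ℝ) : twist * axisRot a = axisRot a * twist := by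
  ext i j
  fin_cases i <;> fin_cases j <;>
    simp [twist, axisRot, Matrix.mul_apply, Matrix.diagonal_apply]

/-- Solutions of `X' = μ X (κ conjBeta (α s))`, `X 0 = 1` are power series in `μ` with twisted
coefficients. -/
lemma exists_twisted_series {α : ℝ → ℝ} (hα : ContinuousOn α (Icc 0 1)) (κ : ℝ) :
    ∃ w : ℕ → M3, w 0 = 1 ∧ (∀ r : ℝ, 0 < r → Summable fun k => ‖w k‖ * r ^ k) ∧
      (∀ k, twist * w k * twist⁻¹ = (-1 : ℝ) ^ k • w k) ∧
      ∀ (μ : ℝ) (X : ℝ → M3), 0 ≤ μ → X 0 = 1 →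
        (∀ s ∈ Icc (0 : ℝ) 1, HasDerivAt X (μ • (X s * (κ • conjBeta (α s)))) s) →
        HasSum (fun k => μ ^ k • w k) (X 1) := by
  -- The Picard lemmas ask for continuity on the whole line, so `α` is extended by its end values
  -- outside `[0, 1]`.
  set C : ℝ → M3 := fun s => κ • conjBeta (IccExtend zero_le_one ((Icc 0 1).domRestrict α) s)
  have hC : Continuous C :=
    (continuous_conjBeta.comp (hα.domRestrict.Icc_extend' (h := zero_le_one))).const_smul κ
  have hCα : ∀ s ∈ Icc (0 : ℝ) 1, C s = κ • conjBeta (α s) := fun s hs => by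
    simp only [C, IccExtend_of_mem zero_le_one _ hs]
    rfl
  refine ⟨fun k => picardCoeff C k 1, rfl, fun r hr => summable_norm_picardCoeff hC hr.le,
    fun k => ?_, fun μ X hμ hX0 hX => hasSum_picardCoeff hC hμ hX0 fun s hs => ?_⟩
  · rw [twist_inv]
    have := map_picardCoeff hC (ContinuousLinearMap.mulLeftRight ℝ M3 twist twist)
      (by simp [twist_mul_twist])
      (fun a b => by
        simp only [ContinuousLinearMap.mulLeftRight_apply]
        -- Inserting `P² = 1` between the factors shows that conjugation by `P` is multiplicative.
        calc twist * (a * b) * twist = twist * a * 1 * b * twist := by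
              rw [mul_one]; simp only [mul_assoc]
          _ = _ := by rw [← twist_mul_twist]; simp only [mul_assoc])
      (fun s => by
        simp only [ContinuousLinearMap.mulLeftRight_apply, C, mul_smul_comm, smul_mul_assoc,
          twist_conjBeta, smul_neg]) k 1
    simpa only [ContinuousLinearMap.mulLeftRight_apply] using this
  · rw [hCα s hs]
    exact hX s hs

/-! ### The corner region -/

lemma mem_uIcc_zero_iff {x u : ℝ} : u ∈ uIcc 0 x ↔ ∃ s ∈ Icc (0 : ℝ) 1, s * x = u := by
  rw [← segment_eq_uIcc, segment_eq_image']
  simp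

/-- Parametrizing by `[0, 1]` makes the parameter range independent of the end point, as the
compactness argument and the Picard series require. -/
lemma mem_axisInterval_iff {D : Set (ℝ × ℝ)} {x : ℝ} :
    x ∈ axisInterval D ↔ ∀ s ∈ Icc (0 : ℝ) 1, (s * x, (0 : ℝ)) ∈ D := by
  simp only [axisInterval, mem_ofPred_eq, mem_uIcc_zero_iff, forall_exists_index, and_imp,
    forall_apply_eq_imp_iff₂]

lemma mem_cornerRegion_iff {D : Set (ℝ × ℝ)} {p : ℝ × ℝ} :
    p ∈ cornerRegion D ↔ ∀ s ∈ Icc (0 : ℝ) 1, (s * p.1, (0 : ℝ)) ∈ D ∧ (p.1, s * p.2) ∈ D := by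
  simp only [cornerRegion, mem_ofPred_eq, mem_axisInterval_iff, mem_uIcc_zero_iff,
    forall_exists_index, and_imp, forall_apply_eq_imp_iff₂, ← forall_and]

/-- By compactness of `[0, 1]`, a condition open in the point and the parameter jointly that holds
along both segments persists for nearby end points. -/
lemma isOpen_cornerRegion {D : Set (ℝ × ℝ)} (hD : IsOpen D) : IsOpen (cornerRegion D) := by
  rw [isOpen_iff_mem_nhds]
  intro p hp
  rw [mem_cornerRegion_iff] at hp
  have h : ∀ᶠ q in nhds p, ∀ s ∈ Icc (0 : ℝ) 1,
      (s * q.1, (0 : ℝ)) ∈ D ∧ (q.1, s * q.2) ∈ D := by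
    refine isCompact_Icc.eventually_forall_of_forall_eventually fun s hs => ?_
    refine Filter.Eventually.and ?_ ?_
    · have hc : Continuous fun z : (ℝ × ℝ) × ℝ => (z.2 * z.1.1, (0 : ℝ)) := by fun_prop
      exact hc.continuousAt.eventually_mem (hD.mem_nhds (hp s hs).1)
    · have hc : Continuous fun z : (ℝ × ℝ) × ℝ => (z.1.1, z.2 * z.1.2) := by fun_prop
      exact hc.continuousAt.eventually_mem (hD.mem_nhds (hp s hs).2)
  filter_upwards [h] with q hq
  exact mem_cornerRegion_iff.2 hq

lemma axisInterval.mem {D : Set (ℝ × ℝ)} {x : ℝ} (hx : x ∈ axisInterval D) :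
    (x, (0 : ℝ)) ∈ D := by
  simpa using mem_axisInterval_iff.1 hx 1 (by simp)

lemma axisInterval.mul_mem {D : Set (ℝ × ℝ)} {x s : ℝ} (hx : x ∈ axisInterval D)
    (hs : s ∈ Icc (0 : ℝ) 1) : s * x ∈ axisInterval D := by
  rw [mem_axisInterval_iff] at hx ⊢
  intro t ht
  rw [← mul_assoc]
  exact hx _ ⟨mul_nonneg ht.1 hs.1, mul_le_one₀ ht.2 hs.1 hs.2⟩

lemma zero_mem_cornerRegion {D : Set (ℝ × ℝ)} (h0 : ((0 : ℝ), (0 : ℝ)) ∈ D) :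
    ((0 : ℝ), (0 : ℝ)) ∈ cornerRegion D := by
  simp [mem_cornerRegion_iff, h0]

/-! ### The leading coefficient on the axis -/

section Frame

variable {D : Set (ℝ × ℝ)} {φ : ℝ × ℝ → ℝ} {U : ℝ × ℝ → Loop}

lemma hasDerivAt_partialX (hD : IsOpen D) (hφ : IsChebyshevAngle D φ) {x y : ℝ}
    (h : (x, y) ∈ D) : HasDerivAt (fun s => φ (s, y)) (partialX φ (x, y)) x := by
  have hd : DifferentiableAt ℝ φ (x, y) :=
    (hφ.smooth.differentiableOn (by simp)).differentiableAt (hD.mem_nhds h)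
  exact (DifferentiableAt.comp (f := fun s : ℝ => (s, y)) x hd (by fun_prop)).hasDerivAt

lemma beta0_eq (φ : ℝ × ℝ → ℝ) (x : ℝ) : beta0 φ x = partialX φ (x, 0) • axisGen := by
  ext i j
  fin_cases i <;> fin_cases j <;> simp [beta0, axisGen]

lemma hasDerivAt_axisRot_angle (hD : IsOpen D) (hφ : IsChebyshevAngle D φ) {x : ℝ}
    (h : (x, (0 : ℝ)) ∈ D) : HasDerivAt (fun x => axisRot (φ (0, 0) - φ (x, 0)))
      (axisRot (φ (0, 0) - φ (x, 0)) * -beta0 φ x) x := by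
  refine ((hasDerivAt_axisRot _).scomp x
    ((hasDerivAt_partialX hD hφ h).const_sub (φ (0, 0)))).congr_deriv ?_
  rw [beta0_eq, neg_smul, mul_neg, mul_smul_comm]

/-- The generator commutes with the rotations, so `β₀` may stand on the left. There it meets, and
cancels, the `-β₀` from the derivative of the left factor in products `V V₀⁻¹` and `U V₀⁻¹`. -/
lemma hasDerivAt_axisRot_neg_angle (hD : IsOpen D) (hφ : IsChebyshevAngle D φ) {x : ℝ}
    (h : (x, (0 : ℝ)) ∈ D) : HasDerivAt (fun x => axisRot (-(φ (0, 0) - φ (x, 0))))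
      (beta0 φ x * axisRot (-(φ (0, 0) - φ (x, 0)))) x := by
  refine ((hasDerivAt_axisRot _).scomp x
    ((hasDerivAt_partialX hD hφ h).const_sub (φ (0, 0))).neg).congr_deriv ?_
  rw [beta0_eq, neg_neg, axisRot_axisGen_comm, smul_mul_assoc]
  rfl

lemma isSolution_axisRot (hD : IsOpen D) (hφ : IsChebyshevAngle D φ) :
    IsSolution φ (axisInterval D) 1 fun x => axisRot (φ (0, 0) - φ (x, 0)) where
  isUnit x _ := isUnit_axisRot _
  differentiable x hx := (hasDerivAt_axisRot_angle hD hφ (axisInterval.mem hx)).differentiableAt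
  eq x hx := by
    refine (congrArg _ (hasDerivAt_axisRot_angle hD hφ (axisInterval.mem hx)).deriv).trans ?_
    rw [axisRot_inv, ← mul_assoc, axisRot_neg_mul, one_mul]
  init := by simp [axisRot_zero]

/-- The quotient of two solutions, `V V₀⁻¹`, has zero derivative along the segment `s ↦ s x` and
equals `1` at its start. -/
lemma IsSolution.eq_axisRot (hD : IsOpen D) (hφ : IsChebyshevAngle D φ) {V : ℝ → M3}
    (hV : IsSolution φ (axisInterval D) 1 V) {x : ℝ} (hx : x ∈ axisInterval D) :
    V x = axisRot (φ (0, 0) - φ (x, 0)) := by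
  have hderiv : ∀ s ∈ Icc (0 : ℝ) 1, HasDerivAt
      (fun s => V (s * x) * axisRot (-(φ (0, 0) - φ (s * x, 0)))) 0 s := fun s hs => by
    have hsx := axisInterval.mul_mem hx hs
    have h1 : HasDerivAt V (V (s * x) * -beta0 φ (s * x)) (s * x) := by
      refine (hV.differentiable _ hsx).hasDerivAt.congr_deriv ?_
      rw [← hV.eq _ hsx, Matrix.mul_nonsing_inv_cancel_left _ _
        ((Matrix.isUnit_iff_isUnit_det _).1 (hV.isUnit _ hsx))]
      rfl
    have h2 := h1.mul (hasDerivAt_axisRot_neg_angle hD hφ (axisInterval.mem hsx))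
    refine (h2.scomp s ((hasDerivAt_id s).mul_const x)).congr_deriv ?_
    simp [mul_assoc]
  have h := constant_of_has_deriv_right_zero
    (fun s hs => (hderiv s hs).continuousAt.continuousWithinAt)
    (fun s hs => (hderiv s (Ico_subset_Icc_self hs)).hasDerivWithinAt) 1 (by simp)
  simp only [one_mul, zero_mul, hV.init, sub_self, neg_zero, axisRot_zero, mul_one] at h
  calc V x = V x * axisRot (-(φ (0, 0) - φ (x, 0))) * axisRot (φ (0, 0) - φ (x, 0)) := by
        rw [mul_assoc, axisRot_neg_mul, mul_one]
    _ = _ := by rw [h, one_mul]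

/-! ### The Birkhoff splitting of the frame -/

lemma IsExtendedFrame.mul_inv (hU : IsExtendedFrame D φ U) {p : ℝ × ℝ} (hp : p ∈ D) (l : Rpos) :
    U p l * (U p l)⁻¹ = 1 := by
  rw [SO_inv (hU.mem_SO p hp l), SO_mul_transpose (hU.mem_SO p hp l)]

lemma IsExtendedFrame.inv_mul (hU : IsExtendedFrame D φ U) {p : ℝ × ℝ} (hp : p ∈ D) (l : Rpos) :
    (U p l)⁻¹ * U p l = 1 := by
  rw [SO_inv (hU.mem_SO p hp l), SO_transpose_mul (hU.mem_SO p hp l)]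

lemma IsExtendedFrame.differentiableAt (hD : IsOpen D) (hU : IsExtendedFrame D φ U) {p : ℝ × ℝ}
    (hp : p ∈ D) (l : Rpos) : DifferentiableAt ℝ (fun q => U q l) p :=
  ((hU.smooth l).differentiableOn (by simp)).differentiableAt (hD.mem_nhds hp)

lemma IsExtendedFrame.hasDerivAt_x (hD : IsOpen D) (hU : IsExtendedFrame D φ U) {x y : ℝ}
    (hp : (x, y) ∈ D) (l : Rpos) :
    HasDerivAt (fun s => U (s, y) l) (U (x, y) l * laxA φ l (x, y)) x := by
  have hd : DifferentiableAt ℝ (fun s => U (s, y) l) x :=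
    DifferentiableAt.comp (f := fun s : ℝ => (s, y)) x (hU.differentiableAt hD hp l) (by fun_prop)
  refine hd.hasDerivAt.congr_deriv ?_
  rw [← hU.lax_x _ hp l, ← mul_assoc, hU.mul_inv hp, one_mul]
  rfl

lemma IsExtendedFrame.hasDerivAt_y (hD : IsOpen D) (hU : IsExtendedFrame D φ U) {x y : ℝ}
    (hp : (x, y) ∈ D) (l : Rpos) :
    HasDerivAt (fun t => U (x, t) l) (U (x, y) l * laxB φ l (x, y)) y := by
  have hd : DifferentiableAt ℝ (fun t => U (x, t) l) y :=
    DifferentiableAt.comp (f := fun t : ℝ => (x, t)) y (hU.differentiableAt hD hp l) (by fun_prop)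
  refine hd.hasDerivAt.congr_deriv ?_
  rw [← hU.lax_y _ hp l, ← mul_assoc, hU.mul_inv hp, one_mul]
  rfl

lemma laxA_axis (φ : ℝ × ℝ → ℝ) (l : Rpos) (x : ℝ) :
    laxA φ l (x, 0) = -beta0 φ x - (l : ℝ) • beta1 := by
  ext i j
  fin_cases i <;> fin_cases j <;> simp [laxA, beta0, beta1]

/-- The plus factor of the frame, as a function on the axis. -/
noncomputable def axisPlus (φ : ℝ × ℝ → ℝ) (U : ℝ × ℝ → Loop) (x : ℝ) : Loop := fun l =>
  U (x, 0) l * axisRot (-(φ (0, 0) - φ (x, 0)))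

/-- The minus factor of the frame. -/
noncomputable def cornerMinus (φ : ℝ × ℝ → ℝ) (U : ℝ × ℝ → Loop) (p : ℝ × ℝ) : Loop := fun l =>
  axisRot (φ (0, 0) - φ (p.1, 0)) * ((U (p.1, 0) l)⁻¹ * U p l)

lemma axisPlus_mem_SO (hU : IsExtendedFrame D φ U) {x : ℝ} (hx : (x, (0 : ℝ)) ∈ D) (l : Rpos) :
    axisPlus φ U x l ∈ Matrix.specialOrthogonalGroup (Fin 3) ℝ :=
  mul_mem (hU.mem_SO _ hx l) (axisRot_mem_SO _)

/-- The product rule gives `U (-β₀ - λ β₁) V₀⁻¹ + U β₀ V₀⁻¹`. What remains is `-λ U β₁ V₀⁻¹ = -λ U₊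
(V₀ β₁ V₀⁻¹)`. -/
lemma hasDerivAt_axisPlus (hD : IsOpen D) (hφ : IsChebyshevAngle D φ)
    (hU : IsExtendedFrame D φ U) {x : ℝ} (hx : (x, (0 : ℝ)) ∈ D) (l : Rpos) :
    HasDerivAt (fun x => axisPlus φ U x l)
      (-(l : ℝ) • (axisPlus φ U x l * conjBeta (φ (0, 0) - φ (x, 0)))) x := by
  refine ((hU.hasDerivAt_x hD hx l).mul (hasDerivAt_axisRot_neg_angle hD hφ hx)).congr_deriv ?_
  set a := φ (0, 0) - φ (x, 0)
  have h : axisPlus φ U x l * conjBeta a = U (x, 0) l * beta1 * axisRot (-a) := by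
    rw [← axisRot_mul_conj]
    calc _ = U (x, 0) l * (axisRot (-a) * axisRot a) * beta1 * axisRot (-a) := by
          simp only [axisPlus, a, mul_assoc]
      _ = _ := by rw [axisRot_neg_mul, mul_one]
  rw [h, laxA_axis]
  simp only [mul_sub, sub_mul, mul_neg, neg_mul, mul_smul_comm, smul_mul_assoc, neg_smul,
    mul_assoc]
  abel

lemma axisPlus_mem_loopPlusStar (hD : IsOpen D) (hφ : IsChebyshevAngle D φ)
    (hU : IsExtendedFrame D φ U) {x : ℝ} (hx : x ∈ axisInterval D) :
    axisPlus φ U x ∈ loopPlusStar := by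
  have hα : ContinuousOn (fun s => φ (0, 0) - φ (s * x, 0)) (Icc 0 1) := by
    refine continuousOn_const.sub
      (hφ.smooth.continuousOn.comp (by fun_prop) (mem_axisInterval_iff.1 hx))
  -- Rescaling the segment to `[0, 1]` contributes the factor `x`. The minus sign of `-λ` is put
  -- into `κ`, so that the series parameter is `λ` itself.
  obtain ⟨w, hw0, hws, hwt, hw⟩ := exists_twisted_series hα (-x)
  refine mem_loopPlusStar_of_hasSum (axisPlus_mem_SO hU (axisInterval.mem hx)) hw0 hws hwt
    fun l => ?_
  have := hw l (fun s => axisPlus φ U (s * x) l) l.2.le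
    (by simp [axisPlus, hU.init, axisRot_zero])
    (fun s hs => by
      have h := (hasDerivAt_axisPlus hD hφ hU (mem_axisInterval_iff.1 hx s hs) l).scomp s
        ((hasDerivAt_id s).mul_const x)
      refine h.congr_deriv ?_
      simp only [one_mul, mul_smul_comm, smul_smul]
      congr 1
      ring)
  simpa using this

/-- On the vertical segment `U(x,0)⁻¹ U(x,ty)` solves `X' = λ⁻¹ X (y · conjBeta φ)` with `X = I` at
`t = 0`. Its series in `1/λ` starts with `I`, and multiplying by `V₀` on the left makes `V₀` the
leading coefficient. -/
lemma hasLeadingCoeff_cornerMinus (hD : IsOpen D) (hφ : IsChebyshevAngle D φ)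
    (hU : IsExtendedFrame D φ U) {p : ℝ × ℝ} (hp : p ∈ cornerRegion D) :
    HasLeadingCoeff (cornerMinus φ U p) (axisRot (φ (0, 0) - φ (p.1, 0))) := by
  obtain ⟨x, y⟩ := p
  have hseg : ∀ s ∈ Icc (0 : ℝ) 1, (x, s * y) ∈ D := fun s hs =>
    (mem_cornerRegion_iff.1 hp s hs).2
  have hx0 : (x, (0 : ℝ)) ∈ D := axisInterval.mem hp.1
  have hxy : (x, y) ∈ D := by simpa using hseg 1 (by simp)
  obtain ⟨w, hw0, hws, hwt, hw⟩ := exists_twisted_series (α := fun s => φ (x, s * y))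
    (hφ.smooth.continuousOn.comp (by fun_prop) hseg) y
  set V := axisRot (φ (0, 0) - φ (x, 0)) with hV
  have key := hasLeadingCoeff_of_hasSum (g := cornerMinus φ U (x, y)) (w := fun k => V * w k)
    (fun l => ?_) (fun r hr => ?_) (fun k => ?_) (fun l => ?_)
  · simpa [hw0] using key
  · refine mul_mem (axisRot_mem_SO _) (mul_mem ?_ (hU.mem_SO _ hxy l))
    rw [SO_inv (hU.mem_SO _ hx0 l)]
    exact SO_transpose_mem (hU.mem_SO _ hx0 l)
  · refine Summable.of_nonneg_of_le (fun k => by positivity) (fun k => ?_)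
      ((hws r hr).mul_left ‖V‖)
    rw [← mul_assoc]
    exact mul_le_mul_of_nonneg_right (norm_mul_le _ _) (by positivity)
  · rw [← mul_assoc, twist_axisRot_comm, mul_assoc, mul_assoc, ← mul_assoc twist, hwt,
      mul_smul_comm]
  · have h := hw (l : ℝ)⁻¹ (fun s => (U (x, 0) l)⁻¹ * U (x, s * y) l) (inv_nonneg.2 l.2.le)
      (by simpa using hU.inv_mul hx0 l)
      (fun s hs => by
        have h := ((hU.hasDerivAt_y hD (hseg s hs) l).scomp s
          ((hasDerivAt_id s).mul_const y)).const_mul (U (x, 0) l)⁻¹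
        refine h.congr_deriv ?_
        have hB : laxB φ l (x, s * y) = (l : ℝ)⁻¹ • conjBeta (φ (x, s * y)) := rfl
        simp only [one_mul, hB, mul_smul_comm, smul_smul, mul_assoc, mul_comm y])
    have h' := h.mul_left V
    simpa [cornerMinus, hV, mul_smul_comm] using h'

lemma isBirkhoffSplitting_frame (hD : IsOpen D) (hφ : IsChebyshevAngle D φ)
    (hU : IsExtendedFrame D φ U) {p : ℝ × ℝ} (hp : p ∈ cornerRegion D) :
    IsBirkhoffSplitting (U p) (axisPlus φ U p.1, cornerMinus φ U p) := by
  refine ⟨axisPlus_mem_loopPlusStar hD hφ hU hp.1,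
    ⟨_, hasLeadingCoeff_cornerMinus hD hφ hU hp⟩, funext fun l => ?_⟩
  set a := φ (0, 0) - φ (p.1, 0)
  change U p l = U (p.1, 0) l * axisRot (-a) * (axisRot a * ((U (p.1, 0) l)⁻¹ * U p l))
  calc U p l = U (p.1, 0) l * (U (p.1, 0) l)⁻¹ * U p l := by
        rw [hU.mul_inv (axisInterval.mem hp.1), one_mul]
    _ = U (p.1, 0) l * (axisRot (-a) * axisRot a) * (U (p.1, 0) l)⁻¹ * U p l := by
        rw [axisRot_neg_mul, mul_one]
    _ = _ := by simp only [mul_assoc]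

lemma hasFDerivAt_plusFactor (hD : IsOpen D) (hφ : IsChebyshevAngle D φ)
    (hU : IsExtendedFrame D φ U) {p : ℝ × ℝ} (hp : p ∈ cornerRegion D) (l : Rpos) :
    HasFDerivAt (fun q => plusFactor U q l)
      (formDx (-(l : ℝ) • (axisPlus φ U p.1 l * conjBeta (φ (0, 0) - φ (p.1, 0))))) p := by
  have h := HasFDerivAt.comp p
    (hasDerivAt_axisPlus hD hφ hU (axisInterval.mem hp.1) l).hasFDerivAt
    (hasFDerivAt_fst (𝕜 := ℝ) (E := ℝ) (F := ℝ) (p := p))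
  refine HasFDerivAt.congr_of_eventuallyEq (h.congr_fderiv ?_) ?_
  · exact ContinuousLinearMap.ext fun v => rfl
  -- Since the region is open, the chosen factor agrees with the explicit one near `p`, not just at
  -- `p`, so the two have the same derivative.
  filter_upwards [(isOpen_cornerRegion hD).mem_nhds hp] with q hq
  rw [plusFactor, (isBirkhoffSplitting_frame hD hφ hU hq).birkhoffFactors_eq]
  rfl

/-- In `-λ⁻¹ U₊⁻¹ dU₊` the factor `U₊` of the differential equation cancels against its inverse, and
`-λ` against `-λ⁻¹`. -/
lemma xPotential_eq (hD : IsOpen D) (hφ : IsChebyshevAngle D φ)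
    (hU : IsExtendedFrame D φ U) {p : ℝ × ℝ} (hp : p ∈ cornerRegion D) (l : Rpos) :
    xPotential U l p = formDx (conjBeta (φ (0, 0) - φ (p.1, 0))) := by
  have hl : (l : ℝ) ≠ 0 := l.2.ne'
  have hG := axisPlus_mem_SO hU (axisInterval.mem hp.1) l
  have hplus : plusFactor U p l = axisPlus φ U p.1 l := by
    rw [plusFactor, (isBirkhoffSplitting_frame hD hφ hU hp).birkhoffFactors_eq]
  refine ContinuousLinearMap.ext fun v => ?_
  set a := φ (0, 0) - φ (p.1, 0)
  have hv : fderiv ℝ (fun q => plusFactor U q l) p v =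
      v.1 • (-(l : ℝ) • (axisPlus φ U p.1 l * conjBeta a)) := by
    rw [(hasFDerivAt_plusFactor hD hφ hU hp l).fderiv]
    rfl
  change (-(l : ℝ)⁻¹) • ((plusFactor U p l)⁻¹ * fderiv ℝ (fun q => plusFactor U q l) p v) =
    v.1 • conjBeta a
  refine (congrArg (fun Y : M3 => (-(l : ℝ)⁻¹) • ((plusFactor U p l)⁻¹ * Y)) hv).trans ?_
  rw [hplus, SO_inv hG, mul_smul_comm, mul_smul_comm, ← mul_assoc, SO_transpose_mul hG, one_mul,
    smul_smul, smul_smul]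
  congr 1
  field_simp

end Frame

/-! ### The potential in `so(3)` and `su(2)`, and the theorem -/

lemma smul_conjBeta_mem_so3 (r a : ℝ) : r • conjBeta a ∈ so3 := by
  rw [LieAlgebra.Orthogonal.mem_so]
  ext i j
  fin_cases i <;> fin_cases j <;> simp [conjBeta]

lemma spinMatrix_smul_conjBeta (r a : ℝ) : spinMatrix (r • conjBeta a) =
    ((r : ℂ) * (Complex.I / 2)) •
      !![0, Complex.exp (Complex.I * ((-a : ℝ) : ℂ)); Complex.exp (Complex.I * (a : ℂ)), 0] := by
  have hexp : ∀ b : ℝ, Complex.exp (Complex.I * (b : ℂ)) = ⟨Real.cos b, Real.sin b⟩ := fun b => by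
    apply Complex.ext <;> simp [Complex.exp_re, Complex.exp_im]
  rw [spinMatrix_eq, hexp, hexp]
  ext i j
  fin_cases i <;> fin_cases j <;> apply Complex.ext <;> simp [conjBeta] <;> ring

end Pseudospherical


theorem theorem6p3p1 (D : Set (ℝ × ℝ)) (hD : IsOpen D) (h0 : ((0 : ℝ), (0 : ℝ)) ∈ D)
    (φ : ℝ × ℝ → ℝ) (hφ : IsChebyshevAngle D φ)
    (U : ℝ × ℝ → Loop) (hU : IsExtendedFrame D φ U) :
    IsOpen (cornerRegion D) ∧ ((0 : ℝ), (0 : ℝ)) ∈ cornerRegion D ∧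
    (∃ V₀ : ℝ → M3, IsSolution φ (axisInterval D) (U (0, 0) 1) V₀) ∧
    ∀ V₀ : ℝ → M3, IsSolution φ (axisInterval D) (U (0, 0) 1) V₀ →
      (∀ x ∈ axisInterval D,
        V₀ x = !![Real.cos (φ (0, 0) - φ (x, 0)), Real.sin (φ (0, 0) - φ (x, 0)), 0;
                  -Real.sin (φ (0, 0) - φ (x, 0)), Real.cos (φ (0, 0) - φ (x, 0)), 0;
                  0, 0, 1]) ∧
      ∀ p ∈ cornerRegion D,
        (∃! q : Loop × Loop, IsBirkhoffSplitting (U p) q) ∧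
        HasLeadingCoeff (minusFactor U p) (V₀ p.1) ∧
        ∀ l : Rpos,
          DifferentiableAt ℝ (fun q => plusFactor U q l) p ∧
          xPotential U l p = formDx (V₀ p.1 * beta1 * (V₀ p.1)⁻¹) ∧
          xPotential U l p = formDx
            !![0, 0, -Real.sin (φ (0, 0) - φ (p.1, 0));
               0, 0, -Real.cos (φ (0, 0) - φ (p.1, 0));
               Real.sin (φ (0, 0) - φ (p.1, 0)), Real.cos (φ (0, 0) - φ (p.1, 0)), 0] ∧
          ∀ v : ℝ × ℝ, ∃ h : xPotential U l p v ∈ so3,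
            (spin ⟨xPotential U l p v, h⟩ : Matrix (Fin 2) (Fin 2) ℂ) =
              ((v.1 : ℂ) * (Complex.I / 2)) •
                !![0, Complex.exp (Complex.I * ((φ (p.1, 0) - φ (0, 0) : ℝ) : ℂ));
                   Complex.exp (Complex.I * ((φ (0, 0) - φ (p.1, 0) : ℝ) : ℂ)), 0] := by
  have hinit : U (0, 0) 1 = 1 := hU.init 1
  rw [hinit]
  refine ⟨isOpen_cornerRegion hD, zero_mem_cornerRegion h0, ⟨_, isSolution_axisRot hD hφ⟩,
    fun V₀ hV₀ => ⟨fun x hx => hV₀.eq_axisRot hD hφ hx, fun p hp => ?_⟩⟩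
  have hsplit := isBirkhoffSplitting_frame hD hφ hU hp
  rw [hV₀.eq_axisRot hD hφ hp.1]
  refine ⟨⟨_, hsplit, fun q hq => hq.unique hsplit⟩, ?_, fun l => ?_⟩
  · rw [minusFactor, hsplit.birkhoffFactors_eq]
    exact hasLeadingCoeff_cornerMinus hD hφ hU hp
  · have hη := xPotential_eq hD hφ hU hp l
    refine ⟨(hasFDerivAt_plusFactor hD hφ hU hp l).differentiableAt, ?_, hη, fun v => ?_⟩
    · rw [hη, axisRot_inv, axisRot_mul_conj]
    · have hv : xPotential U l p v = v.1 • conjBeta (φ (0, 0) - φ (p.1, 0)) := by rw [hη]; rfl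
      refine ⟨hv ▸ smul_conjBeta_mem_so3 _ _, ?_⟩
      change spinMatrix (xPotential U l p v) = _
      rw [hv, spinMatrix_smul_conjBeta, neg_sub]
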